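/- Consider an irrotational equatorial Stokes wave in the $f$-plane approximation, without stagnation points, in the frame moving with the wave speed $c<0$: constants $g,\omega,L>0$, $d$ and $P_{atm}$, a smooth free surface $\eta>-d$, and functions $u,w,P$ that are smooth on the closed domain $D=\{(x,z):-d\le z\le\eta(x)\}$, such that for $-d<z<\eta(x)$ $$(u-c)u_x+wu_z+2\omega w=-P_x,\quad (u-c)w_x+ww_z-2\omega u=-P_z-g,\quad u_x+w_z=0,\quad u_z-w_x=0,$$ with $w=(u-c)\eta_x$ and $P=P_{atm}$ on $z=\eta(x)$, $w=0$ on $z=-d$, and $u>c$ on $D$. Moreover $\eta,u,w$ have period $L$ in $x$; $\eta,u,P$ are even in $x$; and $\eta$ is strictly increasing on $[-L/2,0]$ and strictly decreasing on $[0,L/2]$. Put $$E=\tfrac12\big((u-c)^2+w^2\big),\quad m=\int_{-d}^{\eta(0)}(c-u(0,z))\,dz<0,\quad \varphi_{\max}=\int_{-L/2}^{L/2}(u(x,-d)-c)\,dx .$$ There exist a stream function $\psi$ and a velocity potential $\varphi$, continuous on $D$, with $\psi_z=\varphi_x=u-c$ and $\psi_x=-\varphi_z=-w$ in the interior of $D$,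 normalized by $\psi(0,\eta(0))=0$ and $\varphi(-L/2,-d)=0$. For any such pair, the hodograph transform $f=(\varphi,\psi)$ is a bijection from $D_L=\{(x,z)\in D:|x|\le L/2\}$ onto the rectangle $[0,\varphi_{\max}]\times[m,0]$, in which the side $\psi=0$ corresponds to the free surface and the side $\psi=m$ to the bed. For $s\in(-\infty,-\frac12]\cup[\frac12,\infty)$ and $p\in[0,|m|]$ define the integral mean of $E^s$ along the streamline $\psi=-p$, $$\mathcal M_s(E,p)=\frac1{\varphi_{\max}}\int_0^{\varphi_{\max}}E\big(f^{-1}(q,-p)\big)^s\,dq .$$ The integrand is integrable and $\mathcal M_s(E,p)>0$. Moreover, for every such $s$, the function $p\mapsto\mathcal M_s(E,p)$ is non-increasing and convex on $[0,|m|]$, and $p\mapsto\log\mathcal M_s(E,p)$ is convex on $[0,|m|]$. -/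

import Mathlib

open Set
open scoped ContDiff

noncomputable section

/-- The closed fluid layer `-d ≤ z ≤ η x` over the real line; points are pairs `(x, z)`. -/
def fluidDomain (d : ℝ) (η : ℝ → ℝ) : Set (ℝ × ℝ) :=
  {y | -d ≤ y.2 ∧ y.2 ≤ η y.1}

/-- The partial derivative in the first (horizontal) variable. -/
def partialX (F : ℝ × ℝ → ℝ) (x z : ℝ) : ℝ := deriv (fun t => F (t, z)) x

/-- The partial derivative in the second (vertical) variable. -/
def partialZ (F : ℝ × ℝ → ℝ) (x z : ℝ) : ℝ := deriv (fun t => F (x, t)) z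

/-- An irrotational equatorial Stokes wave in the `f`-plane approximation, without stagnation
points and with unit density, seen in the frame moving with the wave speed `c`.
Only the values of `u`, `w`, `P` on the closed fluid domain matter. -/
structure EquatorialStokesWave where
  /-- gravitational acceleration -/
  g : ℝ
  /-- rotational speed of the Earth -/
  Ω : ℝ
  /-- wave speed (negative: the wave travels westward) -/
  c : ℝ
  /-- the flat bed is `z = -d` -/
  d : ℝ
  /-- period -/
  L : ℝ
  /-- atmospheric pressure -/
  Patm : ℝ
  /-- free surface -/
  η : ℝ → ℝ
  /-- horizontal velocity -/
  u : ℝ × ℝ → ℝ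
  /-- vertical velocity -/
  w : ℝ × ℝ → ℝ
  /-- pressure -/
  P : ℝ × ℝ → ℝ
  g_pos : 0 < g
  Ω_pos : 0 < Ω
  c_neg : c < 0
  L_pos : 0 < L
  bed_lt_surface : ∀ x, -d < η x
  η_smooth : ContDiff ℝ ∞ η
  u_smooth : ContDiffOn ℝ ∞ u (fluidDomain d η)
  w_smooth : ContDiffOn ℝ ∞ w (fluidDomain d η)
  P_smooth : ContDiffOn ℝ ∞ P (fluidDomain d η)
  /-- horizontal momentum -/
  momentum_x : ∀ x z, -d < z → z < η x →
    (u (x, z) - c) * partialX u x z + w (x, z) * partialZ u x z + 2 * Ω * w (x, z)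
      = -partialX P x z
  /-- vertical momentum -/
  momentum_z : ∀ x z, -d < z → z < η x →
    (u (x, z) - c) * partialX w x z + w (x, z) * partialZ w x z - 2 * Ω * u (x, z)
      = -partialZ P x z - g
  /-- mass conservation -/
  incompressible : ∀ x z, -d < z → z < η x → partialX u x z + partialZ w x z = 0
  irrotational : ∀ x z, -d < z → z < η x → partialZ u x z - partialX w x z = 0
  kinematic_surface : ∀ x, w (x, η x) = (u (x, η x) - c) * deriv η x
  dynamic_surface : ∀ x, P (x, η x) = Patm
  kinematic_bed : ∀ x, w (x, -d) = 0
  no_stagnation : ∀ y ∈ fluidDomain d η, c < u y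
  η_periodic : ∀ x, η (x + L) = η x
  u_periodic : ∀ x z, (x, z) ∈ fluidDomain d η → u (x + L, z) = u (x, z)
  w_periodic : ∀ x z, (x, z) ∈ fluidDomain d η → w (x + L, z) = w (x, z)
  η_even : ∀ x, η (-x) = η x
  u_even : ∀ x z, (x, z) ∈ fluidDomain d η → u (-x, z) = u (x, z)
  P_even : ∀ x z, (x, z) ∈ fluidDomain d η → P (-x, z) = P (x, z)
  /-- the surface rises strictly from the trough `x = -L/2` to the crest `x = 0` -/
  η_strictMono : StrictMonoOn η (Icc (-L / 2) 0)
  /-- the surface falls strictly from the crest `x = 0` to the trough `x = L/2` -/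
  η_strictAnti : StrictAntiOn η (Icc 0 (L / 2))

namespace EquatorialStokesWave

/-- The closed fluid domain. -/
def domain (W : EquatorialStokesWave) : Set (ℝ × ℝ) := fluidDomain W.d W.η

/-- The part of the closed fluid domain between two consecutive trough lines. -/
def cell (W : EquatorialStokesWave) : Set (ℝ × ℝ) :=
  {y | y ∈ W.domain ∧ -W.L / 2 ≤ y.1 ∧ y.1 ≤ W.L / 2}

/-- The kinetic energy in the moving frame. -/
def energy (W : EquatorialStokesWave) (y : ℝ × ℝ) : ℝ :=
  ((W.u y - W.c) ^ 2 + W.w y ^ 2) / 2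

/-- The (negative) relative mass flux, computed on the crest line. -/
def massFlux (W : EquatorialStokesWave) : ℝ :=
  ∫ z in (-W.d)..(W.η 0), (W.c - W.u (0, z))

/-- The increment of the velocity potential over one period, computed along the bed. -/
def phiMax (W : EquatorialStokesWave) : ℝ :=
  ∫ x in (-W.L / 2)..(W.L / 2), (W.u (x, -W.d) - W.c)

/-- `ψ` is the stream function (`ψ_z = u - c`, `ψ_x = -w`) and `φ` its harmonic conjugate,
the velocity potential (`φ_x = ψ_z = u - c`, `φ_z = -ψ_x = w`). The two additive constants are
fixed by `ψ = 0` on the free surface and `φ = 0` on the trough line `x = -L/2`, each imposed at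
one point only. -/
structure IsPotentialPair (W : EquatorialStokesWave) (φ ψ : ℝ × ℝ → ℝ) : Prop where
  φ_cont : ContinuousOn φ W.domain
  ψ_cont : ContinuousOn ψ W.domain
  ψ_x : ∀ x z, -W.d < z → z < W.η x → HasDerivAt (fun t => ψ (t, z)) (-W.w (x, z)) x
  ψ_z : ∀ x z, -W.d < z → z < W.η x → HasDerivAt (fun t => ψ (x, t)) (W.u (x, z) - W.c) z
  φ_x : ∀ x z, -W.d < z → z < W.η x → HasDerivAt (fun t => φ (t, z)) (W.u (x, z) - W.c) x
  φ_z : ∀ x z, -W.d < z → z < W.η x → HasDerivAt (fun t => φ (x, t)) (W.w (x, z)) z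
  ψ_crest : ψ (0, W.η 0) = 0
  φ_trough : φ (-W.L / 2, -W.d) = 0

/-- The hodograph transform `f = φ + i ψ`, as a map of the plane. -/
def hodograph (φ ψ : ℝ × ℝ → ℝ) (y : ℝ × ℝ) : ℝ × ℝ := (φ y, ψ y)

/-- The closed hodograph rectangle `0 ≤ φ ≤ φ_max`, `m ≤ ψ ≤ 0`: the side `ψ = 0` corresponds to
the free surface and the side `ψ = m = -|m|` to the bed. -/
def rectangle (W : EquatorialStokesWave) : Set (ℝ × ℝ) :=
  Icc 0 W.phiMax ×ˢ Icc W.massFlux 0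

/-- The energy pulled back by the inverse hodograph transform to the horizontal line `ψ = -p`,
that is, at the level `p ∈ [0, |m|]` below the free surface. -/
def pulledEnergy (W : EquatorialStokesWave) (φ ψ : ℝ × ℝ → ℝ) (p q : ℝ) : ℝ :=
  W.energy (Function.invFunOn (hodograph φ ψ) W.cell (q, -p))

/-- The integral mean `M_s(E, p)`. -/
def energyMean (W : EquatorialStokesWave) (φ ψ : ℝ × ℝ → ℝ) (s p : ℝ) : ℝ :=
  1 / W.phiMax * ∫ q in (0 : ℝ)..W.phiMax, W.pulledEnergy φ ψ p q ^ s

end EquatorialStokesWave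

end

/-!
Write `U = u - c > 0`. Incompressibility and irrotationality say that the complex velocity
`h = U - i w` is holomorphic inside the fluid, and `h = F'` for the complex potential
`F = φ + i ψ`. All that is needed of `h` at the boundary is its continuity: Cauchy's theorem on
rectangles with one side on the bed shows that the functions obtained by integrating the velocity
along the bed and then upwards have the required partial derivatives (`isPotentialPair`), and a
potential pair is unique on the fluid domain (`IsPotentialPair.ext`).

The hodograph transform is bijective because `ψ` increases strictly on vertical lines, from `m` at
the bed to `0` at the surface (`streamFn_surface`, from the kinematic condition), and because `φ`
increases along each streamline at the rate `(U ^ 2 + w ^ 2) / U`, hence at a uniformly positive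
rate (`exists_potentialFn_growth`). The evenness of `u` makes `w` odd, so `w` vanishes on the trough
lines `x = ±L / 2`, which are therefore mapped onto the vertical sides of the rectangle.

Let `K = (h ∘ f⁻¹) ^ s`, so that `E ^ s = 2 ^ (-s) |K| ^ 2` along streamlines. As a function of
`q + i v`, `K` is continuous on the closed rectangle, holomorphic inside, has equal values on the
two vertical sides, and is real on the bed. By Cauchy's theorem the `n`-th Fourier coefficient of
`K` along the level `v` is a constant times `exp (-2 π n v / φ_max)`, so Parseval's identity gives
`M_s(E, p) = ∑ A_n exp (4 π n (p - |m|) / φ_max)` with `A_n ≥ 0`, and `A_{-n} = A_n` since `K` is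
real on the bed (`exists_hasSum_energyMean`). The product of this sum with any exponential
`exp (α p)` is convex, which is equivalent to log-convexity, and by the symmetry of the coefficients
the sum is a series of functions `cosh (4 π n (p - |m|) / φ_max)`, which decrease for `p ≤ |m|`.
-/

open MeasureTheory Filter Topology

/-! ### Periodic holomorphic functions in a strip -/

/-- Cauchy's theorem on a rectangle when the contributions of the two vertical sides cancel. -/
theorem horizontal_integral_eq_of_periodic {Φ v₁ v₂ : ℝ} (hΦ : 0 < Φ) (hv : v₁ ≤ v₂) {K : ℂ → ℂ}
    (hc : ContinuousOn K (Icc 0 Φ ×ℂ Icc v₁ v₂))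
    (hd : DifferentiableOn ℂ K (Ioo 0 Φ ×ℂ Ioo v₁ v₂))
    (hp : ∀ v ∈ Icc v₁ v₂, K (v * Complex.I) = K (Φ + v * Complex.I)) :
    ∫ q in (0 : ℝ)..Φ, K (q + v₁ * Complex.I) = ∫ q in (0 : ℝ)..Φ, K (q + v₂ * Complex.I) := by
  have h := Complex.integral_boundary_rect_eq_zero_of_continuousOn_of_differentiableOn K
    (⟨0, v₁⟩ : ℂ) ⟨Φ, v₂⟩ (by simpa [uIcc_of_le hΦ.le, uIcc_of_le hv] using hc)
    (by simpa [hΦ.le, hv] using hd)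
  have h2 : ∫ y in v₁..v₂, K ((Φ : ℝ) + y * Complex.I) =
      ∫ y in v₁..v₂, K ((0 : ℝ) + y * Complex.I) := by
    refine intervalIntegral.integral_congr fun y hy => ?_
    rw [uIcc_of_le hv] at hy
    simp [hp y hy]
  simp only [h2] at h
  rwa [add_sub_cancel_right, sub_eq_zero] at h

theorem norm_fourierCoeffOn_eq {Φ : ℝ} (hΦ : 0 < Φ) (K : ℂ → ℂ) (n : ℤ) (v : ℝ) :
    ‖fourierCoeffOn hΦ (fun q : ℝ => K (q + v * Complex.I)) n‖ =
      Φ⁻¹ * Real.exp (-(2 * Real.pi * n / Φ * v)) *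
        ‖∫ q in (0 : ℝ)..Φ, Complex.exp (-(2 * Real.pi * n / Φ * Complex.I) *
          (q + v * Complex.I)) * K (q + v * Complex.I)‖ := by
  rw [fourierCoeffOn_eq_integral]
  have : ∀ q : ℝ, (fourier (-n) (q : AddCircle (Φ - 0)) : ℂ) • K (q + v * Complex.I) =
      Real.exp (-(2 * Real.pi * n / Φ * v)) * (Complex.exp (-(2 * Real.pi * n / Φ * Complex.I) *
          (q + v * Complex.I)) * K (q + v * Complex.I)) := by
    intro q
    rw [fourier_coe_apply, smul_eq_mul, ← mul_assoc, Complex.ofReal_exp, ← Complex.exp_add]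
    congr 2
    push_cast
    have : (Φ : ℂ) ≠ 0 := by exact_mod_cast hΦ.ne'
    field_simp
    ring_nf
    simp only [Complex.I_sq]
    ring
  simp only [this, intervalIntegral.integral_const_mul]
  rw [norm_smul, norm_mul, Complex.norm_real, Real.norm_of_nonneg (Real.exp_pos _).le, sub_zero,
    one_div, norm_inv, Real.norm_of_nonneg hΦ.le, ← mul_assoc]

/-- The Fourier coefficients along the levels of a periodic strip are exponentials in the level: the
product of `K` with `exp (-2 π i n ζ / Φ)` is again periodic and holomorphic, so its integral does
not depend on the level. -/
theorem norm_fourierCoeffOn_strip {Φ m : ℝ} (hΦ : 0 < Φ) {K : ℂ → ℂ}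
    (hc : ContinuousOn K (Icc 0 Φ ×ℂ Icc m 0))
    (hd : DifferentiableOn ℂ K (Ioo 0 Φ ×ℂ Ioo m 0))
    (hp : ∀ v ∈ Icc m 0, K (v * Complex.I) = K (Φ + v * Complex.I)) (n : ℤ) {v : ℝ}
    (hv : v ∈ Icc m 0) :
    ‖fourierCoeffOn hΦ (fun q : ℝ => K (q + v * Complex.I)) n‖ =
      Real.exp (2 * Real.pi * n / Φ * (m - v)) *
        ‖fourierCoeffOn hΦ (fun q : ℝ => K (q + m * Complex.I)) n‖ := by
  have hI : Icc m v ⊆ Icc m 0 := Icc_subset_Icc_right hv.2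
  have hE : Differentiable ℂ fun ζ : ℂ => Complex.exp (-(2 * Real.pi * n / Φ * Complex.I) * ζ) := by
    fun_prop
  have key := horizontal_integral_eq_of_periodic hΦ hv.1
    (K := fun ζ => Complex.exp (-(2 * Real.pi * n / Φ * Complex.I) * ζ) * K ζ)
    (hE.continuous.continuousOn.mul (hc.mono fun ζ hζ => ⟨hζ.1, hI hζ.2⟩))
    (hE.differentiableOn.mul (hd.mono fun ζ hζ => ⟨hζ.1, hζ.2.1, hζ.2.2.trans_le hv.2⟩))
    (by
      intro y hy
      rw [← hp y (hI hy)]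
      congr 1
      rw [Complex.exp_eq_exp_iff_exists_int]
      refine ⟨n, ?_⟩
      have : (Φ : ℂ) ≠ 0 := by exact_mod_cast hΦ.ne'
      field_simp
      ring)
  rw [norm_fourierCoeffOn_eq, norm_fourierCoeffOn_eq, key, ← mul_assoc]
  congr 1
  rw [mul_left_comm, ← Real.exp_add]
  congr 2
  ring

theorem norm_fourierCoeffOn_neg_of_real {Φ : ℝ} (hΦ : 0 < Φ) {f : ℝ → ℂ}
    (hr : ∀ q ∈ Icc 0 Φ, (f q).im = 0) (n : ℤ) :
    ‖fourierCoeffOn hΦ f (-n)‖ = ‖fourierCoeffOn hΦ f n‖ := by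
  have : fourierCoeffOn hΦ f (-n) = (starRingEnd ℂ) (fourierCoeffOn hΦ f n) := by
    rw [fourierCoeffOn_eq_integral, fourierCoeffOn_eq_integral, Complex.real_smul,
      Complex.real_smul, map_mul, Complex.conj_ofReal, intervalIntegral.integral_of_le hΦ.le,
      intervalIntegral.integral_of_le hΦ.le, ← integral_conj]
    congr 1
    refine setIntegral_congr_fun measurableSet_Ioc fun q hq => ?_
    simp only [smul_eq_mul, map_mul]
    rw [Complex.conj_eq_iff_im.2 (hr q (Ioc_subset_Icc_self hq)), neg_neg, fourier_neg,
      Complex.conj_conj]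
  rw [this, RCLike.norm_conj]

/-- Parseval's identity on every level of a periodic strip: the mean square of a periodic
holomorphic function along the level `v` is a series of exponentials in `v`. The coefficients are
symmetric in the frequency because the function is real on the bottom level `m`. -/
theorem exists_hasSum_integral_norm_sq {Φ m : ℝ} (hΦ : 0 < Φ) {K : ℂ → ℂ}
    (hc : ContinuousOn K (Icc 0 Φ ×ℂ Icc m 0))
    (hd : DifferentiableOn ℂ K (Ioo 0 Φ ×ℂ Ioo m 0))
    (hp : ∀ v ∈ Icc m 0, K (v * Complex.I) = K (Φ + v * Complex.I))
    (hr : ∀ q ∈ Icc 0 Φ, (K (q + m * Complex.I)).im = 0) :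
    ∃ A : ℤ → ℝ, (∀ n, 0 ≤ A n) ∧ (∀ n, A (-n) = A n) ∧ ∀ v ∈ Icc m 0,
      HasSum (fun n : ℤ => A n * Real.exp (4 * Real.pi * n / Φ * (m - v)))
        (∫ q in (0 : ℝ)..Φ, ‖K (q + v * Complex.I)‖ ^ 2) := by
  refine ⟨fun n => Φ * ‖fourierCoeffOn hΦ (fun q : ℝ => K (q + m * Complex.I)) n‖ ^ 2,
    fun n => by positivity, fun n => by simp only [norm_fourierCoeffOn_neg_of_real hΦ hr],
    fun v hv => ?_⟩
  have hcv : ContinuousOn (fun q : ℝ => K (q + v * Complex.I)) (Icc 0 Φ) := by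
    refine hc.comp (by fun_prop) fun q hq => ⟨?_, ?_⟩ <;> simpa using by assumption
  have hL : MemLp (fun q : ℝ => K (q + v * Complex.I)) 2 (volume.restrict (Ioc 0 Φ)) := by
    obtain ⟨C, hC⟩ := isCompact_Icc.exists_bound_of_continuousOn hcv
    refine MemLp.of_bound ((hcv.mono Ioc_subset_Icc_self).aestronglyMeasurable measurableSet_Ioc) C
      ((ae_restrict_iff' measurableSet_Ioc).2 (ae_of_all _ fun q hq => hC q ?_))
    exact Ioc_subset_Icc_self hq
  have h := (hasSum_sq_fourierCoeffOn hΦ hL).mul_left Φ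
  rw [smul_eq_mul, sub_zero, ← mul_assoc, mul_inv_cancel₀ hΦ.ne', one_mul] at h
  refine h.congr_fun fun n => ?_
  rw [norm_fourierCoeffOn_strip hΦ hc hd hp n hv, mul_pow, ← Real.exp_nat_mul]
  have : ((2 : ℕ) : ℝ) * (2 * Real.pi * n / Φ * (m - v)) = 4 * Real.pi * n / Φ * (m - v) := by
    push_cast; ring
  rw [this]
  ring

theorem convexOn_of_hasSum {ι : Type*} {s : Set ℝ} (hs : Convex ℝ s) {f : ι → ℝ → ℝ} {F : ℝ → ℝ}
    (hf : ∀ i, ConvexOn ℝ s (f i)) (hF : ∀ x ∈ s, HasSum (fun i => f i x) (F x)) :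
    ConvexOn ℝ s F := by
  refine ⟨hs, fun x hx y hy a b ha hb hab => ?_⟩
  exact hasSum_le (fun i => (hf i).2 hx hy ha hb hab) (hF _ (hs hx hy ha hb hab))
    (((hF x hx).const_smul a).add ((hF y hy).const_smul b))

/-- A positive function is log-convex as soon as all its products with exponentials `exp (α x)`
are convex. -/
theorem convexOn_log_of_exp_mul {s : Set ℝ} {F : ℝ → ℝ} (hpos : ∀ x ∈ s, 0 < F x)
    (hF : ∀ α : ℝ, ConvexOn ℝ s fun x => Real.exp (α * x) * F x) :
    ConvexOn ℝ s fun x => Real.log (F x) := by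
  have hs := (hF 0).1
  refine ⟨hs, fun x hx y hy a b ha hb hab => ?_⟩
  rcases eq_or_ne x y with rfl | hxy
  · simp [← add_mul, hab]
  -- this exponent makes the two end values of the product agree
  set α := (Real.log (F x) - Real.log (F y)) / (y - x) with hα
  have hend : α * x + Real.log (F x) = α * y + Real.log (F y) := by
    have : y - x ≠ 0 := sub_ne_zero.2 hxy.symm
    rw [hα]; field_simp; ring
  have hexp : ∀ {t}, t ∈ s → Real.exp (α * t) * F t = Real.exp (α * t + Real.log (F t)) := by
    intro t ht
    rw [Real.exp_add, Real.exp_log (hpos t ht)]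
  have hz := hs hx hy ha hb hab
  have h := (hF α).2 hx hy ha hb hab
  simp only at h
  rw [hexp hz, hexp hx, hexp hy, ← hend, ← add_smul, hab, one_smul, Real.exp_le_exp] at h
  simp only [smul_eq_mul] at h ⊢
  have h3 : b * (α * x + Real.log (F x)) = b * (α * y + Real.log (F y)) := by rw [hend]
  have h4 : a * (α * x + Real.log (F x)) + b * (α * x + Real.log (F x)) =
      α * x + Real.log (F x) := by rw [← add_mul, hab, one_mul]
  nlinarith

theorem convexOn_exp_affine (β γ : ℝ) : ConvexOn ℝ univ fun x : ℝ => Real.exp (β * x + γ) := by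
  refine ⟨convex_univ, fun x _ y _ a b ha hb hab => ?_⟩
  have h := convexOn_exp.2 (mem_univ (β * x + γ)) (mem_univ (β * y + γ)) ha hb hab
  convert h using 2
  simp only [smul_eq_mul]
  linear_combination -γ * hab

theorem convexOn_const_mul_exp_affine {s : Set ℝ} (hs : Convex ℝ s) {A : ℝ} (hA : 0 ≤ A)
    (β γ : ℝ) : ConvexOn ℝ s fun x : ℝ => A * Real.exp (β * x + γ) :=
  ((convexOn_exp_affine β γ).smul hA).subset (subset_univ _) hs

/-- A series of exponentials with nonnegative coefficients stays of this kind, hence convex, after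
multiplication by an exponential. -/
theorem exp_mul_convexOn_of_hasSum {s : Set ℝ} (hs : Convex ℝ s) {A lam : ℤ → ℝ} {μ : ℝ}
    (hA : ∀ n, 0 ≤ A n) {F : ℝ → ℝ}
    (hF : ∀ x ∈ s, HasSum (fun n => A n * Real.exp (lam n * (x - μ))) (F x)) (α : ℝ) :
    ConvexOn ℝ s fun x => Real.exp (α * x) * F x := by
  refine convexOn_of_hasSum hs
    (fun n => convexOn_const_mul_exp_affine hs (hA n) (α + lam n) (-(lam n * μ)))
    fun x hx => ((hF x hx).mul_left (Real.exp (α * x))).congr_fun fun n => ?_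
  rw [mul_left_comm, ← Real.exp_add]
  congr 2
  ring

/-- With coefficients symmetric in the frequency, the series of exponentials in `x - μ` is a series
of hyperbolic cosines, which decreases up to `x = μ`. -/
theorem antitoneOn_of_hasSum_symm {μ k : ℝ} {A : ℤ → ℝ} (hA : ∀ n, 0 ≤ A n)
    (hsymm : ∀ n, A (-n) = A n) {F : ℝ → ℝ}
    (hF : ∀ x ∈ Icc 0 μ, HasSum (fun n : ℤ => A n * Real.exp (k * n * (x - μ))) (F x)) :
    AntitoneOn F (Icc 0 μ) := by
  have hcosh : ∀ x ∈ Icc 0 μ,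
      HasSum (fun n : ℤ => A n * Real.cosh (k * n * (x - μ))) (F x) := by
    intro x hx
    have h1 := hF x hx
    have h2 := (Equiv.neg ℤ).hasSum_iff.2 h1
    have h3 := (h1.add h2).mul_left (1 / 2)
    rw [← two_mul, ← mul_assoc, one_div_mul_cancel (two_ne_zero' ℝ), one_mul] at h3
    refine h3.congr_fun fun n => ?_
    simp only [Function.comp_apply, Equiv.neg_apply, hsymm, Real.cosh_eq]
    push_cast
    ring_nf
  intro x hx y hy hxy
  refine hasSum_le (fun n => ?_) (hcosh y hy) (hcosh x hx)
  refine mul_le_mul_of_nonneg_left ?_ (hA n)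
  rw [Real.cosh_le_cosh, abs_mul, abs_mul (k * n)]
  refine mul_le_mul_of_nonneg_left ?_ (abs_nonneg _)
  rw [abs_of_nonpos (by linarith [hy.2]), abs_of_nonpos (by linarith [hx.2])]
  linarith

/-! ### Functions with prescribed partial derivatives -/

theorem eq_of_hasDerivAt_zero {f : ℝ → ℝ} {a b : ℝ} (hc : ContinuousOn f (Icc a b))
    (hd : ∀ x ∈ Ioo a b, HasDerivAt f 0 x) {x : ℝ} (hx : x ∈ Icc a b) : f x = f a := by
  rcases hx.1.eq_or_lt with rfl | h
  · rfl
  obtain ⟨c, hc1, hc2⟩ := exists_hasDerivAt_eq_slope f (fun _ => 0) h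
    (hc.mono (Icc_subset_Icc_right hx.2)) fun y hy => hd y ⟨hy.1, hy.2.trans_le hx.2⟩
  rw [eq_comm, div_eq_zero_iff] at hc2
  rcases hc2 with h2 | h2 <;> linarith

theorem hasStrictFDerivAt_of_partials {F a b : ℝ × ℝ → ℝ} {y : ℝ × ℝ}
    (ha : ContinuousAt a y) (hb : ContinuousAt b y)
    (h1 : ∀ᶠ v in 𝓝 y, HasDerivAt (fun t => F (t, v.2)) (a v) v.1)
    (h2 : ∀ᶠ v in 𝓝 y, HasDerivAt (fun t => F (v.1, t)) (b v) v.2) :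
    HasStrictFDerivAt F
      ((ContinuousLinearMap.toSpanSingleton ℝ (a y)).coprod
        (ContinuousLinearMap.toSpanSingleton ℝ (b y))) y :=
  hasStrictFDerivAt_uncurry_coprod (f := fun x z => F (x, z))
    (f₁ := fun x z => ContinuousLinearMap.toSpanSingleton ℝ (a (x, z)))
    (f₂ := fun x z => ContinuousLinearMap.toSpanSingleton ℝ (b (x, z)))
    (h1.mono fun _ hv => hv.hasFDerivAt) (h2.mono fun _ hv => hv.hasFDerivAt)
    ((ContinuousLinearMap.toSpanSingletonCLE (𝕜 := ℝ) (E := ℝ)).continuous.continuousAt.comp ha)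
    ((ContinuousLinearMap.toSpanSingletonCLE (𝕜 := ℝ) (E := ℝ)).continuous.continuousAt.comp hb)

theorem eventually_uIcc_of_eventually {p : ℝ → Prop} {x : ℝ} (h : ∀ᶠ t in 𝓝 x, p t) :
    ∀ᶠ t in 𝓝 x, ∀ ξ ∈ uIcc x t, p ξ := by
  obtain ⟨ε, hε, hp⟩ := Metric.eventually_nhds_iff_ball.1 h
  filter_upwards [Metric.ball_mem_nhds x hε] with t ht ξ hξ
  exact hp ξ ((convex_ball x ε).ordConnected.uIcc_subset (Metric.mem_ball_self hε) ht hξ)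

namespace EquatorialStokesWave

variable (W : EquatorialStokesWave)

/-! ### The velocity field -/

/-- The vertical retraction of the plane onto the closed fluid domain. -/
noncomputable def clamp (y : ℝ × ℝ) : ℝ × ℝ := (y.1, max (-W.d) (min (W.η y.1) y.2))

/-- The relative horizontal velocity `u - c`, extended from the fluid domain to the plane so as to
be constant on the vertical half-lines outside the domain. -/
noncomputable def velX (y : ℝ × ℝ) : ℝ := W.u (W.clamp y) - W.c

/-- The vertical velocity `w`, extended from the fluid domain to the plane so as to be constant on
the vertical half-lines outside the domain. -/
noncomputable def velZ (y : ℝ × ℝ) : ℝ := W.w (W.clamp y)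

theorem clamp_mem (y : ℝ × ℝ) : W.clamp y ∈ fluidDomain W.d W.η :=
  ⟨le_max_left _ _, max_le (W.bed_lt_surface _).le (min_le_left _ _)⟩

variable {W} in
theorem clamp_of_mem {y : ℝ × ℝ} (hy : y ∈ fluidDomain W.d W.η) : W.clamp y = y := by
  rw [clamp, min_eq_right hy.2, max_eq_right hy.1]

theorem continuous_η : Continuous W.η := W.η_smooth.continuous

theorem continuous_clamp : Continuous W.clamp := by
  have := W.continuous_η
  unfold clamp
  fun_prop

theorem continuous_velX : Continuous W.velX :=
  (W.u_smooth.continuousOn.comp_continuous W.continuous_clamp W.clamp_mem).sub continuous_const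

theorem continuous_velZ : Continuous W.velZ :=
  W.w_smooth.continuousOn.comp_continuous W.continuous_clamp W.clamp_mem

theorem velX_pos (y : ℝ × ℝ) : 0 < W.velX y :=
  sub_pos.2 (W.no_stagnation _ (W.clamp_mem y))

variable {W}

theorem velX_of_mem {x z : ℝ} (h1 : -W.d ≤ z) (h2 : z ≤ W.η x) :
    W.velX (x, z) = W.u (x, z) - W.c := by
  rw [velX, clamp_of_mem ⟨h1, h2⟩]

theorem velZ_of_mem {x z : ℝ} (h1 : -W.d ≤ z) (h2 : z ≤ W.η x) :
    W.velZ (x, z) = W.w (x, z) := by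
  rw [velZ, clamp_of_mem ⟨h1, h2⟩]

theorem eventually_interior {x z : ℝ} (h1 : -W.d < z) (h2 : z < W.η x) :
    ∀ᶠ y : ℝ × ℝ in 𝓝 (x, z), -W.d < y.2 ∧ y.2 < W.η y.1 := by
  have := W.continuous_η
  refine IsOpen.mem_nhds ?_ ⟨h1, h2⟩
  exact (isOpen_lt continuous_const continuous_snd).inter
    (isOpen_lt continuous_snd (by fun_prop))

theorem fluidDomain_mem_nhds {x z : ℝ} (h1 : -W.d < z) (h2 : z < W.η x) :
    fluidDomain W.d W.η ∈ 𝓝 (x, z) :=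
  (eventually_interior h1 h2).mono fun _ hy => ⟨hy.1.le, hy.2.le⟩

theorem eventually_surface_gt {x z : ℝ} (h2 : z < W.η x) : ∀ᶠ t in 𝓝 x, z < W.η t :=
  W.continuous_η.continuousAt.eventually_const_lt h2

theorem partialX_eq_fderiv {F : ℝ × ℝ → ℝ} {x z : ℝ} (h : DifferentiableAt ℝ F (x, z)) :
    partialX F x z = fderiv ℝ F (x, z) (1, 0) :=
  (h.hasFDerivAt.comp_hasDerivAt x ((hasDerivAt_id x).prodMk (hasDerivAt_const x z))).deriv

theorem partialZ_eq_fderiv {F : ℝ × ℝ → ℝ} {x z : ℝ} (h : DifferentiableAt ℝ F (x, z)) :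
    partialZ F x z = fderiv ℝ F (x, z) (0, 1) :=
  (h.hasFDerivAt.comp_hasDerivAt z ((hasDerivAt_const z x).prodMk (hasDerivAt_id z))).deriv

theorem differentiableAt_u {x z : ℝ} (h1 : -W.d < z) (h2 : z < W.η x) :
    DifferentiableAt ℝ W.u (x, z) :=
  (W.u_smooth.contDiffAt (fluidDomain_mem_nhds h1 h2)).differentiableAt (by simp)

theorem differentiableAt_w {x z : ℝ} (h1 : -W.d < z) (h2 : z < W.η x) :
    DifferentiableAt ℝ W.w (x, z) :=
  (W.w_smooth.contDiffAt (fluidDomain_mem_nhds h1 h2)).differentiableAt (by simp)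

variable (W) in
/-- The complex velocity `(u - c) - i w` as a function of `x + i z`; incompressibility and
irrotationality are its Cauchy–Riemann equations. -/
noncomputable def complexVel (ζ : ℂ) : ℂ :=
  W.velX (ζ.re, ζ.im) - W.velZ (ζ.re, ζ.im) * Complex.I

variable (W) in
theorem continuous_complexVel : Continuous W.complexVel := by
  have := W.continuous_velX
  have := W.continuous_velZ
  unfold complexVel
  fun_prop

theorem complexVel_re (ζ : ℂ) : (W.complexVel ζ).re = W.velX (ζ.re, ζ.im) := by
  simp [complexVel]

theorem complexVel_im (ζ : ℂ) : (W.complexVel ζ).im = -W.velZ (ζ.re, ζ.im) := by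
  simp [complexVel]

theorem differentiableAt_complexVel {ζ : ℂ} (h1 : -W.d < ζ.im) (h2 : ζ.im < W.η ζ.re) :
    DifferentiableAt ℂ W.complexVel ζ := by
  have hu := differentiableAt_u h1 h2
  have hw := differentiableAt_w h1 h2
  have he : HasFDerivAt (fun ζ : ℂ => (ζ.re, ζ.im)) (Complex.equivRealProdCLM : ℂ →L[ℝ] ℝ × ℝ) ζ :=
    Complex.equivRealProdCLM.hasFDerivAt
  have hu' := (Complex.ofRealCLM.hasFDerivAt (x := W.u (ζ.re, ζ.im) - W.c)).comp ζ
    ((hu.hasFDerivAt.comp ζ he).sub_const W.c)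
  have hw' := ((Complex.ofRealCLM.hasFDerivAt (x := W.w (ζ.re, ζ.im))).comp ζ
    (hw.hasFDerivAt.comp ζ he)).mul_const Complex.I
  have hev : W.complexVel =ᶠ[𝓝 ζ] fun ζ : ℂ =>
      ((W.u (ζ.re, ζ.im) - W.c : ℝ) : ℂ) - (W.w (ζ.re, ζ.im) : ℂ) * Complex.I := by
    filter_upwards [he.continuousAt.eventually (eventually_interior h1 h2)] with ξ hξ
    simp only [complexVel, velX_of_mem hξ.1.le hξ.2.le, velZ_of_mem hξ.1.le hξ.2.le]
  have h := (hu'.sub hw').congr_of_eventuallyEq hev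
  rw [differentiableAt_complex_iff_differentiableAt_real]
  refine ⟨h.differentiableAt, ?_⟩
  have e1 := W.incompressible _ _ h1 h2
  have e2 := W.irrotational _ _ h1 h2
  rw [partialX_eq_fderiv hu, partialZ_eq_fderiv hw] at e1
  rw [partialX_eq_fderiv hw, partialZ_eq_fderiv hu] at e2
  rw [h.fderiv]
  apply Complex.ext <;> simp <;> linarith

/-- Cauchy's theorem for the complex velocity on a rectangle in the closed fluid domain, split into
real and imaginary parts. -/
theorem rectangle_circulation_flux {x₁ x₂ z₁ z₂ : ℝ} (h1 : -W.d ≤ z₁) (h12 : z₁ ≤ z₂)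
    (h2 : ∀ x ∈ uIcc x₁ x₂, z₂ ≤ W.η x) :
    ((∫ x in x₁..x₂, W.velX (x, z₁)) - (∫ x in x₁..x₂, W.velX (x, z₂)) +
        (∫ z in z₁..z₂, W.velZ (x₂, z)) - (∫ z in z₁..z₂, W.velZ (x₁, z)) = 0) ∧
      (-(∫ x in x₁..x₂, W.velZ (x, z₁)) + (∫ x in x₁..x₂, W.velZ (x, z₂)) +
        (∫ z in z₁..z₂, W.velX (x₂, z)) - (∫ z in z₁..z₂, W.velX (x₁, z)) = 0) := by
  have h := Complex.integral_boundary_rect_eq_zero_of_continuousOn_of_differentiableOn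
    W.complexVel (⟨x₁, z₁⟩ : ℂ) ⟨x₂, z₂⟩ W.continuous_complexVel.continuousOn ?_
  · have hX := W.continuous_velX
    have hZ := W.continuous_velZ
    have cX : ∀ z, Continuous fun x => W.velX (x, z) := fun z => by fun_prop
    have cZ : ∀ z, Continuous fun x => W.velZ (x, z) := fun z => by fun_prop
    have dX : ∀ x, Continuous fun z => W.velX (x, z) := fun z => by fun_prop
    have dZ : ∀ x, Continuous fun z => W.velZ (x, z) := fun z => by fun_prop
    have split : ∀ (f g : ℝ → ℝ) (a b : ℝ), Continuous f → Continuous g →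
        ∫ t in a..b, ((f t : ℂ) - g t * Complex.I) =
          (∫ t in a..b, f t : ℝ) - (∫ t in a..b, g t : ℝ) * Complex.I := by
      intro f g a b hf hg
      rw [intervalIntegral.integral_sub, intervalIntegral.integral_mul_const,
        intervalIntegral.integral_ofReal, intervalIntegral.integral_ofReal]
      · exact Continuous.intervalIntegrable (by fun_prop) _ _
      · exact Continuous.intervalIntegrable (by fun_prop) _ _
    simp only [complexVel, Complex.add_re, Complex.add_im, Complex.ofReal_re, Complex.ofReal_im,
      Complex.mul_re, Complex.mul_im, Complex.I_re, Complex.I_im, mul_zero, mul_one, sub_zero,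
      zero_add, add_zero] at h
    rw [split _ _ _ _ (cX _) (cZ _), split _ _ _ _ (cX _) (cZ _), split _ _ _ _ (dX _) (dZ _),
      split _ _ _ _ (dX _) (dZ _)] at h
    have hre := congrArg Complex.re h
    have him := congrArg Complex.im h
    simp at hre him
    constructor <;> linarith
  · intro ζ hζ
    rw [min_eq_left (show (⟨x₁, z₁⟩ : ℂ).im ≤ (⟨x₂, z₂⟩ : ℂ).im from h12),
      max_eq_right (show (⟨x₁, z₁⟩ : ℂ).im ≤ (⟨x₂, z₂⟩ : ℂ).im from h12)] at hζ
    exact (differentiableAt_complexVel (h1.trans_lt hζ.2.1) (hζ.2.2.trans_le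
      (h2 _ ⟨hζ.1.1.le, hζ.1.2.le⟩))).differentiableWithinAt

theorem velZ_bed (x : ℝ) : W.velZ (x, -W.d) = 0 := by
  rw [velZ_of_mem le_rfl (W.bed_lt_surface x).le, W.kinematic_bed]

/-- The vertical velocity is odd in `x`: on each vertical line `w (x, ·) + w (-x, ·)` has zero
derivative and it vanishes at the bed. -/
theorem w_odd {x z : ℝ} (h1 : -W.d ≤ z) (h2 : z ≤ W.η x) : W.w (-x, z) = -W.w (x, z) := by
  have hcont : ∀ x, ContinuousOn (fun t => W.w (x, t)) (Icc (-W.d) (W.η x)) := fun x =>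
    W.w_smooth.continuousOn.comp (by fun_prop) fun t ht => ht
  have hder : ∀ x, ∀ t ∈ Ioo (-W.d) (W.η x),
      HasDerivAt (fun t => W.w (x, t)) (-partialX W.u x t) t := by
    intro x t ht
    have h := (differentiableAt_w ht.1 ht.2).comp t
      (f := fun t => (x, t)) (by fun_prop)
    have h' : HasDerivAt (fun t => W.w (x, t)) (partialZ W.w x t) t := h.hasDerivAt
    have := W.incompressible x t ht.1 ht.2
    rwa [show partialZ W.w x t = -partialX W.u x t by linarith] at h'
  have hη := W.η_even x
  have key := eq_of_hasDerivAt_zero (f := fun t => W.w (x, t) + W.w (-x, t))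
    (a := -W.d) (b := W.η x) ((hcont x).add (by simpa [hη] using hcont (-x))) ?_ ⟨h1, h2⟩
  · simp only [W.kinematic_bed] at key
    linarith
  · intro t ht
    have h := (hder x t ht).add (hder (-x) t (by rwa [hη]))
    have hs : partialX W.u (-x) t = -partialX W.u x t := by
      have hev : (fun ξ => W.u (-ξ, t)) =ᶠ[𝓝 x] fun ξ => W.u (ξ, t) := by
        filter_upwards [eventually_surface_gt ht.2] with ξ hξ
        exact W.u_even ξ t ⟨ht.1.le, hξ.le⟩
      have h1 := hev.deriv_eq
      rw [deriv_comp_neg (fun ξ => W.u (ξ, t))] at h1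
      simp only [partialX]
      linarith
    rw [hs, add_neg_cancel] at h
    exact h

variable (W) in
theorem η_right : W.η (W.L / 2) = W.η (-W.L / 2) := by
  rw [← W.η_periodic (-W.L / 2)]; ring_nf

variable (W) in
theorem clamp_right (z : ℝ) : W.clamp (W.L / 2, z) = (W.L / 2, (W.clamp (-W.L / 2, z)).2) := by
  simp [clamp, η_right]

variable (W) in
theorem velX_right (z : ℝ) : W.velX (W.L / 2, z) = W.velX (-W.L / 2, z) := by
  have h : W.u (-W.L / 2 + W.L, (W.clamp (-W.L / 2, z)).2) = W.u (W.clamp (-W.L / 2, z)) :=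
    W.u_periodic _ _ (W.clamp_mem (-W.L / 2, z))
  rw [velX, velX, clamp_right, ← h]
  ring_nf

variable (W) in
theorem velZ_right_eq (z : ℝ) : W.velZ (W.L / 2, z) = W.velZ (-W.L / 2, z) := by
  have h : W.w (-W.L / 2 + W.L, (W.clamp (-W.L / 2, z)).2) = W.w (W.clamp (-W.L / 2, z)) :=
    W.w_periodic _ _ (W.clamp_mem (-W.L / 2, z))
  rw [velZ, velZ, clamp_right, ← h]
  ring_nf

variable (W) in
theorem velZ_trough (z : ℝ) : W.velZ (-W.L / 2, z) = 0 := by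
  have h := W.clamp_mem (W.L / 2, z)
  have h1 := w_odd h.1 h.2
  have h2 := velZ_right_eq W z
  rw [velZ, velZ] at h2
  have h3 : W.clamp (-W.L / 2, z) = (-(W.clamp (W.L / 2, z)).1, (W.clamp (W.L / 2, z)).2) := by
    simp [clamp, η_right, neg_div]
  rw [velZ, h3]
  rw [h3] at h2
  change W.w (W.clamp (W.L / 2, z)) = _ at h2
  change _ = -W.w (W.clamp (W.L / 2, z)) at h1
  linarith

end EquatorialStokesWave

namespace EquatorialStokesWave

/-! ### Stream function and velocity potential -/

variable (W : EquatorialStokesWave)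

/-- The stream function, integrated upwards from the bed. -/
noncomputable def streamFn (y : ℝ × ℝ) : ℝ :=
  W.massFlux + ∫ t in (-W.d)..y.2, W.velX (y.1, t)

/-- The velocity potential, integrated along the bed and then upwards. -/
noncomputable def potentialFn (y : ℝ × ℝ) : ℝ :=
  (∫ t in (-W.L / 2)..y.1, W.velX (t, -W.d)) + ∫ t in (-W.d)..y.2, W.velZ (y.1, t)

theorem continuous_streamFn : Continuous W.streamFn :=
  continuous_const.add ((intervalIntegral.continuous_parametric_primitive_of_continuous
    (f := fun x t => W.velX (x, t)) W.continuous_velX).comp continuous_id)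

theorem continuous_velX_fst (z : ℝ) : Continuous fun x => W.velX (x, z) :=
  W.continuous_velX.comp (by fun_prop)

theorem continuous_velX_snd (x : ℝ) : Continuous fun z => W.velX (x, z) :=
  W.continuous_velX.comp (by fun_prop)

theorem continuous_velZ_fst (z : ℝ) : Continuous fun x => W.velZ (x, z) :=
  W.continuous_velZ.comp (by fun_prop)

theorem continuous_velZ_snd (x : ℝ) : Continuous fun z => W.velZ (x, z) :=
  W.continuous_velZ.comp (by fun_prop)

theorem continuous_potentialFn : Continuous W.potentialFn := by
  refine Continuous.add ?_ ((intervalIntegral.continuous_parametric_primitive_of_continuous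
    (f := fun x t => W.velZ (x, t)) W.continuous_velZ).comp continuous_id)
  exact (intervalIntegral.continuous_primitive
    (fun a b => (W.continuous_velX_fst _).intervalIntegrable a b) _).comp continuous_fst

theorem hasDerivAt_streamFn_z (x z : ℝ) :
    HasDerivAt (fun t => W.streamFn (x, t)) (W.velX (x, z)) z :=
  ((W.continuous_velX_snd x).integral_hasStrictDerivAt _ z).hasDerivAt.const_add _

theorem hasDerivAt_potentialFn_z (x z : ℝ) :
    HasDerivAt (fun t => W.potentialFn (x, t)) (W.velZ (x, z)) z :=
  ((W.continuous_velZ_snd x).integral_hasStrictDerivAt (-W.d) z).hasDerivAt.const_add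
    (∫ t in (-W.L / 2)..x, W.velX (t, -W.d))

variable {W}

theorem hasDerivAt_streamFn_x {x z : ℝ} (h1 : -W.d < z) (h2 : z < W.η x) :
    HasDerivAt (fun t => W.streamFn (t, z)) (-W.velZ (x, z)) x := by
  have h := ((W.continuous_velZ_fst z).integral_hasStrictDerivAt x x).hasDerivAt.const_sub
    (W.streamFn (x, z))
  refine h.congr_of_eventuallyEq ?_
  filter_upwards [eventually_uIcc_of_eventually (eventually_surface_gt h2)] with t ht
  have h3 := (rectangle_circulation_flux le_rfl h1.le fun ξ hξ => (ht ξ hξ).le).2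
  simp only [velZ_bed, intervalIntegral.integral_zero] at h3
  simp only [streamFn]
  linarith

theorem hasDerivAt_potentialFn_x {x z : ℝ} (h1 : -W.d < z) (h2 : z < W.η x) :
    HasDerivAt (fun t => W.potentialFn (t, z)) (W.velX (x, z)) x := by
  have h := ((W.continuous_velX_fst z).integral_hasStrictDerivAt x x).hasDerivAt.const_add
    (W.potentialFn (x, z))
  refine h.congr_of_eventuallyEq ?_
  filter_upwards [eventually_uIcc_of_eventually (eventually_surface_gt h2)] with t ht
  have h3 := (rectangle_circulation_flux le_rfl h1.le fun ξ hξ => (ht ξ hξ).le).1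
  have h4 := intervalIntegral.integral_add_adjacent_intervals (μ := volume) (a := -W.L / 2)
    (b := x) (c := t)
    ((W.continuous_velX_fst (-W.d)).intervalIntegrable _ _)
    ((W.continuous_velX_fst (-W.d)).intervalIntegrable _ _)
  simp only [potentialFn]
  linarith

theorem hasStrictFDerivAt_streamFn {x z : ℝ} (h1 : -W.d < z) (h2 : z < W.η x) :
    HasStrictFDerivAt W.streamFn
      ((ContinuousLinearMap.toSpanSingleton ℝ (-W.velZ (x, z))).coprod
        (ContinuousLinearMap.toSpanSingleton ℝ (W.velX (x, z)))) (x, z) :=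
  hasStrictFDerivAt_of_partials (a := fun y => -W.velZ y) (b := W.velX)
    W.continuous_velZ.neg.continuousAt W.continuous_velX.continuousAt
    ((eventually_interior h1 h2).mono fun _ hv => hasDerivAt_streamFn_x hv.1 hv.2)
    (Eventually.of_forall fun v => W.hasDerivAt_streamFn_z v.1 v.2)

theorem hasStrictFDerivAt_potentialFn {x z : ℝ} (h1 : -W.d < z) (h2 : z < W.η x) :
    HasStrictFDerivAt W.potentialFn
      ((ContinuousLinearMap.toSpanSingleton ℝ (W.velX (x, z))).coprod
        (ContinuousLinearMap.toSpanSingleton ℝ (W.velZ (x, z)))) (x, z) :=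
  hasStrictFDerivAt_of_partials (a := W.velX) (b := W.velZ)
    W.continuous_velX.continuousAt W.continuous_velZ.continuousAt
    ((eventually_interior h1 h2).mono fun _ hv => hasDerivAt_potentialFn_x hv.1 hv.2)
    (Eventually.of_forall fun v => W.hasDerivAt_potentialFn_z v.1 v.2)

variable (W) in
theorem streamFn_bed (x : ℝ) : W.streamFn (x, -W.d) = W.massFlux := by
  simp [streamFn]

variable (W) in
theorem streamFn_crest : W.streamFn (0, W.η 0) = 0 := by
  have h : W.massFlux = -∫ z in (-W.d)..(W.η 0), W.velX (0, z) := by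
    rw [massFlux, ← intervalIntegral.integral_neg]
    refine intervalIntegral.integral_congr fun z hz => ?_
    rw [uIcc_of_le (W.bed_lt_surface 0).le] at hz
    simp only [velX_of_mem hz.1 hz.2]
    ring
  rw [streamFn, h]
  simp

/-- The stream function is constant along the free surface. Its derivative along the curves
`z = η x - δ` inside the fluid is integrated and `δ` tends to zero; the limit of the integrand
vanishes by the kinematic boundary condition. -/
theorem streamFn_surface_eq (a b : ℝ) : W.streamFn (b, W.η b) = W.streamFn (a, W.η a) := by
  have hη := W.continuous_η
  have hη' : Continuous (deriv W.η) := W.η_smooth.continuous_deriv (by simp)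
  have hX := W.continuous_velX
  have hZ := W.continuous_velZ
  have hS := W.continuous_streamFn
  set G : ℝ → ℝ → ℝ := fun δ x =>
    -W.velZ (x, W.η x - δ) + W.velX (x, W.η x - δ) * deriv W.η x with hG
  have hGc : Continuous G.uncurry := by
    simp only [hG, Function.uncurry_def]
    fun_prop
  have hlim : Continuous fun δ => (W.streamFn (b, W.η b - δ) - W.streamFn (a, W.η a - δ)) -
      ∫ x in a..b, G δ x :=
    Continuous.sub (by fun_prop)
      (intervalIntegral.continuous_parametric_intervalIntegral_of_continuous' hGc a b)
  obtain ⟨x₀, -, hx₀⟩ := isCompact_uIcc.exists_isMinOn (nonempty_uIcc (a := a) (b := b))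
    hη.continuousOn
  have hpos : 0 < W.η x₀ + W.d := by linarith [W.bed_lt_surface x₀]
  have hzero : ∀ᶠ δ in 𝓝[>] (0 : ℝ), (W.streamFn (b, W.η b - δ) - W.streamFn (a, W.η a - δ)) -
      ∫ x in a..b, G δ x = 0 := by
    filter_upwards [Ioo_mem_nhdsGT hpos] with δ hδ
    rw [sub_eq_zero, eq_comm]
    refine intervalIntegral.integral_eq_sub_of_hasDerivAt (f := fun x => W.streamFn (x, W.η x - δ))
      (fun x hx => ?_)
      ((hGc.comp (Continuous.prodMk_right δ)).intervalIntegrable a b)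
    have hmin : W.η x₀ ≤ W.η x := hx₀ hx
    have h := (hasStrictFDerivAt_streamFn (W := W) (x := x) (z := W.η x - δ)
      (by linarith [hδ.2]) (by linarith [hδ.1])).hasFDerivAt.comp_hasDerivAt x
      ((hasDerivAt_id x).prodMk
        (((W.η_smooth.differentiable (by simp)) x).hasDerivAt.sub_const δ))
    have hval : G δ x = ((ContinuousLinearMap.toSpanSingleton ℝ (-W.velZ (x, W.η x - δ))).coprod
        (ContinuousLinearMap.toSpanSingleton ℝ (W.velX (x, W.η x - δ)))) (1, deriv W.η x) := by
      simp [hG, mul_comm]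
    rw [hval]
    exact h
  have h0 := tendsto_nhds_unique ((hlim.tendsto 0).mono_left nhdsWithin_le_nhds)
    (tendsto_const_nhds.congr' (hzero.mono fun _ h => h.symm))
  have hG0 : ∀ x, G 0 x = 0 := by
    intro x
    have hb := (W.bed_lt_surface x).le
    simp only [hG, sub_zero, velX_of_mem hb le_rfl, velZ_of_mem hb le_rfl, W.kinematic_surface]
    ring
  simp only [hG0, intervalIntegral.integral_zero, sub_zero] at h0
  linarith

variable (W) in
theorem streamFn_surface (x : ℝ) : W.streamFn (x, W.η x) = 0 := by
  rw [streamFn_surface_eq 0 x, streamFn_crest]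

variable (W) in
/-- The potential vanishes on the whole trough line, because `w` does. -/
theorem potentialFn_left (z : ℝ) : W.potentialFn (-W.L / 2, z) = 0 := by
  simp [potentialFn, velZ_trough]

variable (W) in
theorem potentialFn_right (z : ℝ) : W.potentialFn (W.L / 2, z) = W.phiMax := by
  simp only [potentialFn, velZ_right_eq, velZ_trough, intervalIntegral.integral_zero, add_zero,
    phiMax]
  refine intervalIntegral.integral_congr fun x _ => ?_
  exact velX_of_mem le_rfl (W.bed_lt_surface x).le

variable (W) in
theorem streamFn_right (z : ℝ) : W.streamFn (W.L / 2, z) = W.streamFn (-W.L / 2, z) := by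
  simp [streamFn, velX_right]

variable (W) in
theorem isPotentialPair : W.IsPotentialPair W.potentialFn W.streamFn where
  φ_cont := W.continuous_potentialFn.continuousOn
  ψ_cont := W.continuous_streamFn.continuousOn
  ψ_x _ _ h1 h2 := velZ_of_mem h1.le h2.le ▸ hasDerivAt_streamFn_x h1 h2
  ψ_z _ _ h1 h2 := velX_of_mem h1.le h2.le ▸ W.hasDerivAt_streamFn_z _ _
  φ_x _ _ h1 h2 := velX_of_mem h1.le h2.le ▸ hasDerivAt_potentialFn_x h1 h2
  φ_z _ _ h1 h2 := velZ_of_mem h1.le h2.le ▸ W.hasDerivAt_potentialFn_z _ _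
  ψ_crest := W.streamFn_crest
  φ_trough := W.potentialFn_left _

theorem hasDerivAt_sub_zero {f g : ℝ → ℝ} {c x : ℝ} (hf : HasDerivAt f c x)
    (hg : HasDerivAt g c x) : HasDerivAt (fun t => f t - g t) 0 x := by
  have h := hf.sub hg
  rw [sub_self] at h
  exact h

/-- The function is constant on vertical lines, so its values on the bed are, locally in `x`, its
values at some fixed interior height. -/
theorem eq_of_partials_zero {F : ℝ × ℝ → ℝ} (hF : ContinuousOn F W.domain)
    (h1 : ∀ x z, -W.d < z → z < W.η x → HasDerivAt (fun t => F (t, z)) 0 x)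
    (h2 : ∀ x z, -W.d < z → z < W.η x → HasDerivAt (fun t => F (x, t)) 0 z)
    {y y' : ℝ × ℝ} (hy : y ∈ W.domain) (hy' : y' ∈ W.domain) : F y = F y' := by
  have hvert : ∀ {x z : ℝ}, -W.d ≤ z → z ≤ W.η x → F (x, z) = F (x, -W.d) := by
    intro x z hz hz'
    refine eq_of_hasDerivAt_zero (f := fun t => F (x, t)) (b := W.η x)
      (hF.comp (by fun_prop) fun t ht => ht) (fun t ht => h2 x t ht.1 ht.2) ⟨hz, hz'⟩
  have hbed : ∀ x, HasDerivAt (fun t => F (t, -W.d)) 0 x := by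
    intro x
    obtain ⟨z, hz, hz'⟩ := exists_between (W.bed_lt_surface x)
    refine (h1 x z hz hz').congr_of_eventuallyEq ?_
    filter_upwards [eventually_surface_gt hz'] with t ht
    exact (hvert hz.le ht.le).symm
  rw [← Prod.mk.eta (p := y), ← Prod.mk.eta (p := y'), hvert hy.1 hy.2, hvert hy'.1 hy'.2]
  exact is_const_of_deriv_eq_zero (fun x => (hbed x).differentiableAt)
    (fun x => (hbed x).deriv) _ _

theorem IsPotentialPair.ext {φ ψ φ' ψ' : ℝ × ℝ → ℝ} (h : W.IsPotentialPair φ ψ)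
    (h' : W.IsPotentialPair φ' ψ') : EqOn φ φ' W.domain ∧ EqOn ψ ψ' W.domain := by
  constructor
  · intro y hy
    have := eq_of_partials_zero (F := fun y => φ y - φ' y) (h.φ_cont.sub h'.φ_cont)
      (fun x z h1 h2 => hasDerivAt_sub_zero (h.φ_x x z h1 h2) (h'.φ_x x z h1 h2))
      (fun x z h1 h2 => hasDerivAt_sub_zero (h.φ_z x z h1 h2) (h'.φ_z x z h1 h2)) hy
      (y' := (-W.L / 2, -W.d)) ⟨le_rfl, (W.bed_lt_surface _).le⟩
    simp only [h.φ_trough, h'.φ_trough] at this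
    linarith
  · intro y hy
    have := eq_of_partials_zero (F := fun y => ψ y - ψ' y) (h.ψ_cont.sub h'.ψ_cont)
      (fun x z h1 h2 => hasDerivAt_sub_zero (h.ψ_x x z h1 h2) (h'.ψ_x x z h1 h2))
      (fun x z h1 h2 => hasDerivAt_sub_zero (h.ψ_z x z h1 h2) (h'.ψ_z x z h1 h2)) hy
      (y' := (0, W.η 0)) ⟨(W.bed_lt_surface _).le, le_rfl⟩
    simp only [h.ψ_crest, h'.ψ_crest] at this
    linarith

end EquatorialStokesWave

/-- The solution `Z p` of `G p (Z p) = c p` depends continuously on `p` when `G p` is strictly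
increasing; no differentiability is needed. -/
theorem continuousOn_of_strictMono_implicit {X : Type*} [TopologicalSpace X] {G : X → ℝ → ℝ}
    (hG : ∀ z, Continuous fun p => G p z) (hmono : ∀ p, StrictMono (G p)) {c Z : X → ℝ}
    (hc : Continuous c) {S : Set X} (hZ : ∀ p ∈ S, G p (Z p) = c p) : ContinuousOn Z S := by
  intro p hp
  refine tendsto_order.2 ⟨fun a ha => ?_, fun a ha => ?_⟩
  · have h : G p a < c p := hZ p hp ▸ hmono p ha
    filter_upwards [nhdsWithin_le_nhds ((hG a).continuousAt.eventually_lt hc.continuousAt h),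
      self_mem_nhdsWithin] with q hq hqS
    rw [← hZ q hqS] at hq
    exact (hmono q).lt_iff_lt.1 hq
  · have h : c p < G p a := hZ p hp ▸ hmono p ha
    filter_upwards [nhdsWithin_le_nhds (hc.continuousAt.eventually_lt (hG a).continuousAt h),
      self_mem_nhdsWithin] with q hq hqS
    rw [← hZ q hqS] at hq
    exact (hmono q).lt_iff_lt.1 hq

/-- Implicit differentiation along a continuous curve of solutions `(t, Z t)` of `F = const`. -/
theorem hasDerivAt_of_implicit {F : ℝ × ℝ → ℝ} {a b x : ℝ} {Z : ℝ → ℝ}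
    (hF : HasStrictFDerivAt F ((ContinuousLinearMap.toSpanSingleton ℝ a).coprod
      (ContinuousLinearMap.toSpanSingleton ℝ b)) (x, Z x)) (hb : b ≠ 0)
    (hZ : ContinuousAt Z x) (hFZ : ∀ t, F (t, Z t) = F (x, Z x)) :
    HasDerivAt Z (-a / b) x := by
  have hinv : (((ContinuousLinearMap.toSpanSingleton ℝ a).coprod
      (ContinuousLinearMap.toSpanSingleton ℝ b)) ∘L
        ContinuousLinearMap.inr ℝ ℝ ℝ).IsInvertible := by
    refine ⟨ContinuousLinearEquiv.unitsEquivAut ℝ (Units.mk0 b hb), ?_⟩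
    ext
    simp
  have hev := hF.eventually_apply_eq_iff_implicitFunctionOfProdDomain hinv
  have hev2 : Z =ᶠ[𝓝 x] hF.implicitFunctionOfProdDomain hinv := by
    have hcont : Tendsto (fun t => (t, Z t)) (𝓝 x) (𝓝 (x, Z x)) :=
      (continuousAt_id (x := x)).prodMk hZ
    filter_upwards [hcont.eventually hev] with t ht
    exact (ht.1 (hFZ t)).symm
  have hd : DifferentiableAt ℝ Z x :=
    ((hF.hasStrictFDerivAt_implicitFunctionOfProdDomain
      hinv).hasFDerivAt.congr_of_eventuallyEq hev2).differentiableAt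
  have hchain := hF.hasFDerivAt.comp_hasDerivAt x ((hasDerivAt_id x).prodMk hd.hasDerivAt)
  have hconst : HasDerivAt (F ∘ fun t => (id t, Z t)) 0 x := by
    have : (F ∘ fun t => (id t, Z t)) = fun _ => F (x, Z x) := funext hFZ
    rw [this]
    exact hasDerivAt_const _ _
  have h0 := hchain.unique hconst
  simp at h0
  have : deriv Z x = -a / b := by
    field_simp
    linarith
  rw [← this]
  exact hd.hasDerivAt

namespace EquatorialStokesWave

/-! ### Streamlines and the hodograph transform -/

variable (W : EquatorialStokesWave)

theorem strictMono_streamFn (x : ℝ) : StrictMono fun z => W.streamFn (x, z) :=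
  strictMono_of_deriv_pos fun z => by
    rw [(W.hasDerivAt_streamFn_z x z).deriv]
    exact W.velX_pos _

theorem massFlux_neg : W.massFlux < 0 := by
  have h := W.strictMono_streamFn 0 (W.bed_lt_surface 0)
  simpa only [streamFn_bed, streamFn_surface] using h

variable {W} in
theorem streamFn_mem_Icc {x z : ℝ} (h1 : -W.d ≤ z) (h2 : z ≤ W.η x) :
    W.streamFn (x, z) ∈ Icc W.massFlux 0 := by
  rw [← W.streamFn_bed x, ← W.streamFn_surface x]
  exact ⟨(W.strictMono_streamFn x).monotone h1, (W.strictMono_streamFn x).monotone h2⟩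

/-- The height at horizontal position `x` of the streamline on which the stream function has the
value `s`. -/
noncomputable def streamlineHeight (x s : ℝ) : ℝ :=
  Function.invFunOn (fun z => W.streamFn (x, z)) (Icc (-W.d) (W.η x)) s

variable {W}

theorem mem_image_streamFn {x s : ℝ} (hs : s ∈ Icc W.massFlux 0) :
    s ∈ (fun z => W.streamFn (x, z)) '' Icc (-W.d) (W.η x) := by
  have h := intermediate_value_Icc (f := fun z => W.streamFn (x, z)) (W.bed_lt_surface x).le
    (W.continuous_streamFn.comp (by fun_prop)).continuousOn
  simp only [streamFn_bed, streamFn_surface] at h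
  exact h hs

theorem streamlineHeight_mem {x s : ℝ} (hs : s ∈ Icc W.massFlux 0) :
    W.streamlineHeight x s ∈ Icc (-W.d) (W.η x) :=
  Function.invFunOn_mem (mem_image_streamFn hs)

theorem streamFn_streamlineHeight {x s : ℝ} (hs : s ∈ Icc W.massFlux 0) :
    W.streamFn (x, W.streamlineHeight x s) = s :=
  Function.invFunOn_eq (mem_image_streamFn hs)

theorem eq_streamlineHeight {x z s : ℝ} (hs : s ∈ Icc W.massFlux 0) (h : W.streamFn (x, z) = s) :
    z = W.streamlineHeight x s :=
  (W.strictMono_streamFn x).injective (h.trans (streamFn_streamlineHeight hs).symm)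

theorem interior_of_streamFn_mem_Ioo {x z : ℝ} (h : W.streamFn (x, z) ∈ Ioo W.massFlux 0) :
    -W.d < z ∧ z < W.η x := by
  rw [← W.streamFn_bed x, ← W.streamFn_surface x] at h
  exact ⟨(W.strictMono_streamFn x).lt_iff_lt.1 h.1, (W.strictMono_streamFn x).lt_iff_lt.1 h.2⟩

variable (W) in
theorem continuousOn_streamlineHeight :
    ContinuousOn (fun p : ℝ × ℝ => W.streamlineHeight p.1 p.2) (univ ×ˢ Icc W.massFlux 0) := by
  have := W.continuous_streamFn
  exact continuousOn_of_strictMono_implicit (G := fun p z => W.streamFn (p.1, z)) (c := Prod.snd)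
    (fun z => by fun_prop) (fun p => W.strictMono_streamFn p.1) continuous_snd
    fun p hp => streamFn_streamlineHeight hp.2

theorem continuous_streamlineHeight_fst {s : ℝ} (hs : s ∈ Icc W.massFlux 0) :
    Continuous fun x => W.streamlineHeight x s :=
  W.continuousOn_streamlineHeight.comp_continuous (f := fun x => (x, s)) (by fun_prop)
    fun _ => ⟨mem_univ _, hs⟩

theorem continuousOn_streamlineHeight_snd (x : ℝ) :
    ContinuousOn (fun s => W.streamlineHeight x s) (Icc W.massFlux 0) :=
  W.continuousOn_streamlineHeight.comp (f := fun s => (x, s)) (by fun_prop)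
    fun _ hs => ⟨mem_univ _, hs⟩

/-- Along an interior streamline the potential grows at the rate `(U ^ 2 + w ^ 2) / U`, where
`U = u - c`. -/
theorem hasDerivAt_potentialFn_streamline {s : ℝ} (hs : s ∈ Ioo W.massFlux 0) (x : ℝ) :
    HasDerivAt (fun x => W.potentialFn (x, W.streamlineHeight x s))
      (W.velX (x, W.streamlineHeight x s) + W.velZ (x, W.streamlineHeight x s) ^ 2 /
        W.velX (x, W.streamlineHeight x s)) x := by
  have hs' := Ioo_subset_Icc_self hs
  have hin : -W.d < W.streamlineHeight x s ∧ W.streamlineHeight x s < W.η x :=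
    interior_of_streamFn_mem_Ioo (by rwa [streamFn_streamlineHeight hs'])
  have hZ := hasDerivAt_of_implicit (Z := fun x => W.streamlineHeight x s)
    (hasStrictFDerivAt_streamFn hin.1 hin.2) (W.velX_pos _).ne'
    (continuous_streamlineHeight_fst hs').continuousAt
    fun t => by rw [streamFn_streamlineHeight hs', streamFn_streamlineHeight hs']
  have h := (hasStrictFDerivAt_potentialFn hin.1 hin.2).hasFDerivAt.comp_hasDerivAt x
    ((hasDerivAt_id x).prodMk hZ)
  rw [neg_neg] at h
  have hval : ((ContinuousLinearMap.toSpanSingleton ℝ (W.velX (x, W.streamlineHeight x s))).coprod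
      (ContinuousLinearMap.toSpanSingleton ℝ (W.velZ (x, W.streamlineHeight x s))))
        (1, W.velZ (x, W.streamlineHeight x s) / W.velX (x, W.streamlineHeight x s)) =
      W.velX (x, W.streamlineHeight x s) + W.velZ (x, W.streamlineHeight x s) ^ 2 /
        W.velX (x, W.streamlineHeight x s) := by
    simp
    ring
  rw [← hval]
  exact h

variable (W) in
theorem isCompact_cell_params :
    IsCompact (Icc (-W.L / 2) (W.L / 2) ×ˢ Icc W.massFlux 0) := isCompact_Icc.prod isCompact_Icc

/-- On all streamlines, including the bed and the free surface, the potential grows at a uniformly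
positive rate over a period. -/
theorem exists_potentialFn_growth : ∃ κ > 0, ∀ s ∈ Icc W.massFlux 0,
    ∀ a ∈ Icc (-W.L / 2) (W.L / 2), ∀ b ∈ Icc (-W.L / 2) (W.L / 2), a ≤ b →
      κ * (b - a) ≤ W.potentialFn (b, W.streamlineHeight b s) -
        W.potentialFn (a, W.streamlineHeight a s) := by
  have hL := W.L_pos
  have hm := W.massFlux_neg
  have hc : ContinuousOn (fun p : ℝ × ℝ => W.velX (p.1, W.streamlineHeight p.1 p.2))
      (Icc (-W.L / 2) (W.L / 2) ×ˢ Icc W.massFlux 0) :=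
    W.continuous_velX.comp_continuousOn (continuousOn_fst.prodMk
      (W.continuousOn_streamlineHeight.mono (prod_mono_left (subset_univ _))))
  obtain ⟨p, -, hp⟩ := W.isCompact_cell_params.exists_isMinOn
    ⟨(0, 0), ⟨by constructor <;> linarith, ⟨hm.le, le_rfl⟩⟩⟩ hc
  refine ⟨_, W.velX_pos (p.1, W.streamlineHeight p.1 p.2), fun s hs a ha b hb hab => ?_⟩
  set κ := W.velX (p.1, W.streamlineHeight p.1 p.2)
  have hin : ∀ s ∈ Ioo W.massFlux 0, κ * (b - a) ≤ W.potentialFn (b, W.streamlineHeight b s) -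
      W.potentialFn (a, W.streamlineHeight a s) := by
    intro s hs
    have hd := fun x => hasDerivAt_potentialFn_streamline hs x
    refine (convex_Icc (-W.L / 2) (W.L / 2)).mul_sub_le_image_sub_of_le_deriv
      (fun x _ => (hd x).continuousAt.continuousWithinAt)
      (fun x _ => (hd x).differentiableAt.differentiableWithinAt) (fun x hx => ?_) a ha b hb hab
    rw [(hd x).deriv]
    have h1 : κ ≤ W.velX (x, W.streamlineHeight x s) :=
      hp (show (x, s) ∈ _ from ⟨interior_subset hx, Ioo_subset_Icc_self hs⟩)
    have h2 := W.velX_pos (x, W.streamlineHeight x s)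
    have : 0 ≤ W.velZ (x, W.streamlineHeight x s) ^ 2 / W.velX (x, W.streamlineHeight x s) := by
      positivity
    linarith
  -- the bed and the free surface are limits of interior streamlines
  have hφ : ∀ x, ContinuousOn (fun s => W.potentialFn (x, W.streamlineHeight x s))
      (Icc W.massFlux 0) := fun x =>
    W.continuous_potentialFn.comp_continuousOn
      (continuousOn_const.prodMk (continuousOn_streamlineHeight_snd x))
  rw [← closure_Ioo hm.ne] at hs
  refine ContinuousWithinAt.closure_le hs continuousWithinAt_const ?_ hin
  have hs' := hs
  rw [closure_Ioo hm.ne] at hs'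
  exact (((hφ b).sub (hφ a)) s hs').mono Ioo_subset_Icc_self

theorem strictMonoOn_potentialFn_streamline {s : ℝ} (hs : s ∈ Icc W.massFlux 0) :
    StrictMonoOn (fun x => W.potentialFn (x, W.streamlineHeight x s))
      (Icc (-W.L / 2) (W.L / 2)) := by
  obtain ⟨κ, hκ, h⟩ := exists_potentialFn_growth (W := W)
  intro a ha b hb hab
  have := h s hs a ha b hb hab.le
  have := mul_pos hκ (sub_pos.2 hab)
  simp only
  linarith

variable (W) in
theorem phiMax_pos : 0 < W.phiMax := by
  have hL := W.L_pos
  have hm := W.massFlux_neg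
  have := strictMonoOn_potentialFn_streamline (W := W) ⟨hm.le, le_rfl⟩
    (left_mem_Icc.2 (by linarith)) (right_mem_Icc.2 (by linarith)) (by linarith)
  simpa [potentialFn_left, potentialFn_right] using this

variable (W) in
/-- A point of the cell is determined by its streamline and the value of the potential on it. -/
theorem bijOn_hodograph : BijOn (hodograph W.potentialFn W.streamFn) W.cell W.rectangle := by
  have hL := W.L_pos
  have hle : -W.L / 2 ≤ W.L / 2 := by linarith
  refine ⟨?_, ?_, ?_⟩
  · rintro ⟨x, z⟩ ⟨⟨h1, h2⟩, hx⟩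
    have hs := streamFn_mem_Icc h1 h2
    have hz := eq_streamlineHeight hs rfl
    have hmono := (strictMonoOn_potentialFn_streamline hs).monotoneOn
    have ha := hmono (left_mem_Icc.2 hle) hx hx.1
    have hb := hmono hx (right_mem_Icc.2 hle) hx.2
    simp only [potentialFn_left, potentialFn_right, ← hz] at ha hb
    exact ⟨⟨ha, hb⟩, hs⟩
  · rintro ⟨x, z⟩ ⟨⟨h1, h2⟩, hx⟩ ⟨x', z'⟩ ⟨⟨h1', h2'⟩, hx'⟩ heq
    obtain ⟨e1, e2⟩ := Prod.mk.inj heq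
    have hs := streamFn_mem_Icc h1 h2
    have hz := eq_streamlineHeight hs rfl
    have hz' := eq_streamlineHeight hs e2.symm
    have hxx : x = x' := by
      refine (strictMonoOn_potentialFn_streamline hs).injOn hx hx' ?_
      simp only [← hz, ← hz', e1]
    subst hxx
    exact Prod.ext rfl (hz.trans hz'.symm)
  · rintro ⟨q, s⟩ ⟨hq, hs⟩
    have hc : Continuous fun x => W.potentialFn (x, W.streamlineHeight x s) :=
      W.continuous_potentialFn.comp
        (continuous_id.prodMk (continuous_streamlineHeight_fst hs))
    have hivt := intermediate_value_Icc hle hc.continuousOn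
    simp only [potentialFn_left, potentialFn_right] at hivt
    obtain ⟨x, hx, hxq⟩ := hivt hq
    exact ⟨(x, W.streamlineHeight x s), ⟨streamlineHeight_mem hs, hx⟩,
      Prod.ext hxq (streamFn_streamlineHeight hs)⟩

end EquatorialStokesWave

theorem continuousOn_rightInverse_of_isCompact {X Y : Type*} [TopologicalSpace X]
    [TopologicalSpace Y] [T2Space Y] {f : X → Y} {g : Y → X} {s : Set X} {t : Set Y}
    (hs : IsCompact s) (hf : ContinuousOn f s) (hinj : InjOn f s) (hg : MapsTo g t s)
    (hfg : ∀ y ∈ t, f (g y) = y) : ContinuousOn g t := by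
  refine continuousOn_iff_isClosed.2 fun C hC =>
    ⟨f '' (s ∩ C), ((hs.inter_right hC).image_of_continuousOn
      (hf.mono inter_subset_left)).isClosed, ?_⟩
  ext y
  refine ⟨fun ⟨hy, hyt⟩ => ⟨⟨g y, ⟨hg hyt, hy⟩, hfg y hyt⟩, hyt⟩, ?_⟩
  rintro ⟨⟨x, ⟨hxs, hxC⟩, hxy⟩, hyt⟩
  refine ⟨?_, hyt⟩
  rw [← hfg y hyt] at hxy
  rw [mem_preimage, ← hinj hxs (hg hyt) hxy]
  exact hxC

namespace EquatorialStokesWave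

/-! ### The complex velocity in the hodograph plane -/

variable {W : EquatorialStokesWave}

variable (W) in
theorem isCompact_cell : IsCompact W.cell := by
  have h := W.isCompact_cell_params.image_of_continuousOn
    (f := fun p : ℝ × ℝ => (p.1, W.streamlineHeight p.1 p.2))
    (continuousOn_fst.prodMk
      (W.continuousOn_streamlineHeight.mono (prod_mono_left (subset_univ _))))
  convert h using 1
  ext ⟨x, z⟩
  constructor
  · rintro ⟨⟨h1, h2⟩, hx⟩
    have hs := streamFn_mem_Icc h1 h2
    exact ⟨(x, W.streamFn (x, z)), ⟨hx, hs⟩, Prod.ext rfl (eq_streamlineHeight hs rfl).symm⟩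
  · rintro ⟨⟨x', s⟩, ⟨hx, hs⟩, heq⟩
    rw [← heq]
    exact ⟨streamlineHeight_mem hs, hx⟩

variable (W) in
/-- A right inverse of the hodograph transform from the rectangle into the cell. -/
structure IsHodographInverse (g : ℝ × ℝ → ℝ × ℝ) : Prop where
  mapsTo : MapsTo g W.rectangle W.cell
  right_inv : ∀ r ∈ W.rectangle, hodograph W.potentialFn W.streamFn (g r) = r

variable {g : ℝ × ℝ → ℝ × ℝ}

theorem IsHodographInverse.continuousOn (hg : W.IsHodographInverse g) :
    ContinuousOn g W.rectangle :=
  continuousOn_rightInverse_of_isCompact W.isCompact_cell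
    (W.continuous_potentialFn.prodMk W.continuous_streamFn).continuousOn W.bijOn_hodograph.injOn
    hg.mapsTo hg.right_inv

theorem IsHodographInverse.apply_hodograph (hg : W.IsHodographInverse g) {y : ℝ × ℝ}
    (hy : y ∈ W.cell) : g (hodograph W.potentialFn W.streamFn y) = y := by
  have hr := W.bijOn_hodograph.mapsTo hy
  exact W.bijOn_hodograph.injOn (hg.mapsTo hr) hy (hg.right_inv _ hr)

theorem hasDerivAt_complexPotential {ζ : ℂ} (h1 : -W.d < ζ.im) (h2 : ζ.im < W.η ζ.re) :
    HasDerivAt (fun ζ : ℂ => (W.potentialFn (ζ.re, ζ.im) : ℂ) +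
      W.streamFn (ζ.re, ζ.im) * Complex.I) (W.complexVel ζ) ζ := by
  have he : HasFDerivAt (fun ζ : ℂ => (ζ.re, ζ.im)) (Complex.equivRealProdCLM : ℂ →L[ℝ] ℝ × ℝ) ζ :=
    Complex.equivRealProdCLM.hasFDerivAt
  have hφ := (Complex.ofRealCLM.hasFDerivAt (x := W.potentialFn (ζ.re, ζ.im))).comp ζ
    ((hasStrictFDerivAt_potentialFn h1 h2).hasFDerivAt.comp ζ he)
  have hψ := ((Complex.ofRealCLM.hasFDerivAt (x := W.streamFn (ζ.re, ζ.im))).comp ζ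
    ((hasStrictFDerivAt_streamFn h1 h2).hasFDerivAt.comp ζ he)).mul_const Complex.I
  refine hasDerivAt_iff_hasFDerivAt.2 (hasFDerivAt_of_restrictScalars ℝ (hφ.add hψ) ?_)
  ext
  apply Complex.ext <;> simp [complexVel]

/-- A map of the plane, written as a function of a complex variable. -/
def toComplexMap (g : ℝ × ℝ → ℝ × ℝ) (ζ : ℂ) : ℂ := ⟨(g (ζ.re, ζ.im)).1, (g (ζ.re, ζ.im)).2⟩

theorem continuousOn_toComplexMap {A B : Set ℝ} (hg : ContinuousOn g (A ×ˢ B)) :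
    ContinuousOn (toComplexMap g) (A ×ℂ B) :=
  Complex.equivRealProdCLM.symm.continuous.comp_continuousOn
    (hg.comp (f := fun ζ : ℂ => (ζ.re, ζ.im)) (by fun_prop) fun _ hζ => hζ)

theorem IsHodographInverse.interior (hg : W.IsHodographInverse g) {r : ℝ × ℝ}
    (h1 : r.1 ∈ Icc 0 W.phiMax) (h2 : r.2 ∈ Ioo W.massFlux 0) :
    -W.d < (g r).2 ∧ (g r).2 < W.η (g r).1 := by
  have h : W.streamFn (g r) = r.2 :=
    congrArg Prod.snd (hg.right_inv r ⟨h1, Ioo_subset_Icc_self h2⟩)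
  rw [← h] at h2
  exact interior_of_streamFn_mem_Ioo h2

theorem IsHodographInverse.differentiableAt (hg : W.IsHodographInverse g) {ζ : ℂ}
    (hζ : ζ ∈ Ioo 0 W.phiMax ×ℂ Ioo W.massFlux 0) :
    DifferentiableAt ℂ (toComplexMap g) ζ := by
  have hin := hg.interior (r := (ζ.re, ζ.im)) (Ioo_subset_Icc_self hζ.1) hζ.2
  have hnhds : Ioo 0 W.phiMax ×ℂ Ioo W.massFlux 0 ∈ 𝓝 ζ :=
    (isOpen_Ioo.reProdIm isOpen_Ioo).mem_nhds hζ
  have hsub : Ioo 0 W.phiMax ×ℂ Ioo W.massFlux 0 ⊆ Icc 0 W.phiMax ×ℂ Icc W.massFlux 0 :=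
    fun ξ hξ => ⟨Ioo_subset_Icc_self hξ.1, Ioo_subset_Icc_self hξ.2⟩
  refine (HasDerivAt.of_local_left_inverse
    (((continuousOn_toComplexMap hg.continuousOn).mono hsub).continuousAt hnhds)
    (hasDerivAt_complexPotential (ζ := toComplexMap g ζ) hin.1 hin.2) ?_ ?_).differentiableAt
  · intro h0
    have := congrArg Complex.re h0
    rw [complexVel_re] at this
    exact (W.velX_pos _).ne' this
  · filter_upwards [hnhds] with ξ hξ
    have h := hg.right_inv (ξ.re, ξ.im) (hsub hξ)
    have h1 := congrArg Prod.fst h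
    have h2 := congrArg Prod.snd h
    simp only [hodograph] at h1 h2
    simp only [toComplexMap, Prod.mk.eta, h1, h2, Complex.re_add_im]

variable (W) in
theorem complexVel_mem_slitPlane (ζ : ℂ) : W.complexVel ζ ∈ Complex.slitPlane :=
  Or.inl (by rw [complexVel_re]; exact W.velX_pos _)

theorem energy_eq {y : ℝ × ℝ} (hy : y ∈ W.domain) :
    W.energy y = ‖W.complexVel ⟨y.1, y.2⟩‖ ^ 2 / 2 := by
  rw [Complex.sq_norm, Complex.normSq_apply, complexVel_re, complexVel_im,
    velX_of_mem hy.1 hy.2, velZ_of_mem hy.1 hy.2, energy]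
  ring

theorem energy_rpow_eq {y : ℝ × ℝ} (hy : y ∈ W.domain) (s : ℝ) :
    W.energy y ^ s = (1 / 2) ^ s * ‖W.complexVel ⟨y.1, y.2⟩ ^ (s : ℂ)‖ ^ 2 := by
  rw [energy_eq hy, Complex.norm_cpow_real, div_eq_inv_mul, ← one_div,
    Real.mul_rpow (by norm_num) (by positivity), ← Real.rpow_natCast, ← Real.rpow_natCast,
    ← Real.rpow_mul (norm_nonneg _), ← Real.rpow_mul (norm_nonneg _), mul_comm s]

variable (W) in
/-- A power of the complex velocity as a function of the hodograph variable `q + i v`. -/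
noncomputable def velPow (g : ℝ × ℝ → ℝ × ℝ) (s : ℝ) (ζ : ℂ) : ℂ :=
  W.complexVel (toComplexMap g ζ) ^ (s : ℂ)

theorem energy_rpow_apply (hg : W.IsHodographInverse g) (s : ℝ) {q v : ℝ}
    (h : (q, v) ∈ W.rectangle) :
    W.energy (g (q, v)) ^ s = (1 / 2) ^ s * ‖W.velPow g s (q + v * Complex.I)‖ ^ 2 := by
  rw [energy_rpow_eq (hg.mapsTo h).1, velPow, toComplexMap]
  simp

theorem continuousOn_velPow (hg : W.IsHodographInverse g) (s : ℝ) :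
    ContinuousOn (W.velPow g s) (Icc 0 W.phiMax ×ℂ Icc W.massFlux 0) :=
  ContinuousOn.cpow_const
    (W.continuous_complexVel.comp_continuousOn (continuousOn_toComplexMap hg.continuousOn))
    fun _ _ => W.complexVel_mem_slitPlane _

theorem differentiableOn_velPow (hg : W.IsHodographInverse g) (s : ℝ) :
    DifferentiableOn ℂ (W.velPow g s) (Ioo 0 W.phiMax ×ℂ Ioo W.massFlux 0) := by
  intro ζ hζ
  have hin := hg.interior (r := (ζ.re, ζ.im)) (Ioo_subset_Icc_self hζ.1) hζ.2
  exact (((differentiableAt_complexVel (ζ := toComplexMap g ζ) hin.1 hin.2).comp ζ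
    (hg.differentiableAt hζ)).cpow_const (W.complexVel_mem_slitPlane _)).differentiableWithinAt

/-- The vertical sides of the rectangle correspond to consecutive trough lines, on which the
velocities agree by periodicity. -/
theorem velPow_periodic (hg : W.IsHodographInverse g) (s : ℝ) {v : ℝ}
    (hv : v ∈ Icc W.massFlux 0) :
    W.velPow g s (v * Complex.I) = W.velPow g s (W.phiMax + v * Complex.I) := by
  have hL := W.L_pos
  set z := W.streamlineHeight (-W.L / 2) v with hz
  have hzm : z ∈ Icc (-W.d) (W.η (-W.L / 2)) := streamlineHeight_mem hv
  have hzv : W.streamFn (-W.L / 2, z) = v := streamFn_streamlineHeight hv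
  have h1 : g (0, v) = (-W.L / 2, z) := by
    have := hg.apply_hodograph (y := (-W.L / 2, z)) ⟨hzm, le_rfl, by simp only; linarith⟩
    rwa [hodograph, potentialFn_left, hzv] at this
  have h2 : g (W.phiMax, v) = (W.L / 2, z) := by
    have := hg.apply_hodograph (y := (W.L / 2, z))
      ⟨⟨hzm.1, by simpa only [η_right] using hzm.2⟩, by simp only; linarith, le_rfl⟩
    rwa [hodograph, potentialFn_right, streamFn_right, hzv] at this
  simp [velPow, toComplexMap, h1, h2, complexVel, velX_right, velZ_right_eq]

/-- On the bed the vertical velocity vanishes, so the complex velocity is a positive number. -/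
theorem velPow_bed_im (hg : W.IsHodographInverse g) (s : ℝ) {q : ℝ}
    (hq : q ∈ Icc 0 W.phiMax) : (W.velPow g s (q + W.massFlux * Complex.I)).im = 0 := by
  have h : W.streamFn (g (q, W.massFlux)) = W.massFlux :=
    congrArg Prod.snd (hg.right_inv (q, W.massFlux) ⟨hq, le_rfl, W.massFlux_neg.le⟩)
  have hbed : (g (q, W.massFlux)).2 = -W.d :=
    (W.strictMono_streamFn (g (q, W.massFlux)).1).injective (h.trans (W.streamFn_bed _).symm)
  simp only [velPow, toComplexMap, complexVel, Complex.add_re, Complex.add_im, Complex.ofReal_re,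
    Complex.ofReal_im, Complex.mul_re, Complex.mul_im, Complex.I_re, Complex.I_im, mul_zero,
    mul_one, sub_zero, zero_add, add_zero, hbed, velZ_bed, Complex.ofReal_zero, zero_mul]
  rw [← Complex.ofReal_cpow (W.velX_pos _).le, Complex.ofReal_im]

/-! ### Energy means along streamlines -/

theorem neg_mem_Icc_massFlux {p : ℝ} (hp : p ∈ Icc 0 |W.massFlux|) : -p ∈ Icc W.massFlux 0 := by
  rw [abs_of_neg W.massFlux_neg] at hp
  constructor <;> linarith [hp.1, hp.2]

theorem continuousOn_energy_rpow (hg : W.IsHodographInverse g) (s : ℝ) {p : ℝ}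
    (hp : p ∈ Icc 0 |W.massFlux|) :
    ContinuousOn (fun q => W.energy (g (q, -p)) ^ s) (Icc 0 W.phiMax) := by
  have hc : ContinuousOn (fun q : ℝ => (1 / 2) ^ s *
      ‖W.velPow g s (q + (-p : ℝ) * Complex.I)‖ ^ 2) (Icc 0 W.phiMax) := by
    refine (((continuousOn_velPow hg s).comp (by fun_prop) fun q hq => ?_).norm.pow 2).const_mul _
    have := neg_mem_Icc_massFlux hp
    constructor <;> simpa
  exact hc.congr fun q hq => energy_rpow_apply hg s ⟨hq, neg_mem_Icc_massFlux hp⟩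

theorem energy_pos {y : ℝ × ℝ} (hy : y ∈ W.domain) : 0 < W.energy y := by
  have := sub_pos.2 (W.no_stagnation y hy)
  unfold energy
  positivity

theorem integral_energy_rpow_pos (hg : W.IsHodographInverse g) (s : ℝ) {p : ℝ}
    (hp : p ∈ Icc 0 |W.massFlux|) : 0 < ∫ q in (0 : ℝ)..W.phiMax, W.energy (g (q, -p)) ^ s :=
  intervalIntegral.intervalIntegral_pos_of_pos_on
    ((continuousOn_energy_rpow hg s hp).intervalIntegrable_of_Icc W.phiMax_pos.le)
    (fun q hq => Real.rpow_pos_of_pos (energy_pos (hg.mapsTo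
      (show (q, -p) ∈ W.rectangle from
        ⟨Ioo_subset_Icc_self hq, neg_mem_Icc_massFlux hp⟩)).1) s) W.phiMax_pos

theorem exists_hasSum_energyMean (hg : W.IsHodographInverse g) (s : ℝ) :
    ∃ A : ℤ → ℝ, (∀ n, 0 ≤ A n) ∧ (∀ n, A (-n) = A n) ∧ ∀ p ∈ Icc 0 |W.massFlux|,
      HasSum (fun n : ℤ => A n * Real.exp (4 * Real.pi / W.phiMax * n * (p - |W.massFlux|)))
        (1 / W.phiMax * ∫ q in (0 : ℝ)..W.phiMax, W.energy (g (q, -p)) ^ s) := by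
  obtain ⟨A, hA, hsymm, hsum⟩ := exists_hasSum_integral_norm_sq W.phiMax_pos
    (continuousOn_velPow hg s) (differentiableOn_velPow hg s)
    (fun v hv => velPow_periodic hg s hv) (fun q hq => velPow_bed_im hg s hq)
  have hΦ := W.phiMax_pos
  refine ⟨fun n => 1 / W.phiMax * (1 / 2) ^ s * A n,
    fun n => mul_nonneg (by positivity) (hA n), fun n => by simp only [hsymm], fun p hp => ?_⟩
  have hv := neg_mem_Icc_massFlux hp
  have h := (hsum (-p) hv).mul_left (1 / W.phiMax * (1 / 2) ^ s)
  have hint : ∫ q in (0 : ℝ)..W.phiMax, W.energy (g (q, -p)) ^ s = (1 / 2) ^ s *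
      ∫ q in (0 : ℝ)..W.phiMax, ‖W.velPow g s (q + (-p : ℝ) * Complex.I)‖ ^ 2 := by
    rw [← intervalIntegral.integral_const_mul]
    refine intervalIntegral.integral_congr fun q hq => ?_
    rw [uIcc_of_le hΦ.le] at hq
    exact energy_rpow_apply hg s ⟨hq, hv⟩
  rw [hint, ← mul_assoc]
  refine h.congr_fun fun n => ?_
  rw [abs_of_neg W.massFlux_neg, mul_assoc (1 / W.phiMax * (1 / 2) ^ s)]
  congr 3
  ring

/-- By uniqueness, every potential pair has the same hodograph transform on the cell. -/
theorem IsPotentialPair.eqOn_hodograph {φ ψ : ℝ × ℝ → ℝ} (h : W.IsPotentialPair φ ψ) :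
    EqOn (hodograph W.potentialFn W.streamFn) (hodograph φ ψ) W.cell := by
  obtain ⟨h1, h2⟩ := h.ext W.isPotentialPair
  exact fun y hy => Prod.ext (h1 hy.1).symm (h2 hy.1).symm

theorem IsPotentialPair.isHodographInverse {φ ψ : ℝ × ℝ → ℝ} (h : W.IsPotentialPair φ ψ) :
    W.IsHodographInverse (Function.invFunOn (hodograph φ ψ) W.cell) := by
  have himg : hodograph φ ψ '' W.cell = W.rectangle :=
    (W.bijOn_hodograph.congr h.eqOn_hodograph).image_eq
  have hmem : ∀ r ∈ W.rectangle, r ∈ hodograph φ ψ '' W.cell := fun r hr => by rwa [himg]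
  have hmaps : MapsTo (Function.invFunOn (hodograph φ ψ) W.cell) W.rectangle W.cell :=
    fun r hr => Function.invFunOn_mem (hmem r hr)
  exact ⟨hmaps, fun r hr => (h.eqOn_hodograph (hmaps hr)).trans
    (Function.invFunOn_eq (hmem r hr))⟩

end EquatorialStokesWave

theorem theorem3p1 (W : EquatorialStokesWave) :
    (∃ φ ψ : ℝ × ℝ → ℝ, W.IsPotentialPair φ ψ) ∧
    ∀ φ ψ : ℝ × ℝ → ℝ, W.IsPotentialPair φ ψ →
      BijOn (EquatorialStokesWave.hodograph φ ψ) W.cell W.rectangle ∧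
      ∀ s : ℝ, s ∈ Iic (-(1 / 2) : ℝ) ∪ Ici (1 / 2 : ℝ) →
        (∀ p ∈ Icc 0 |W.massFlux|,
          IntervalIntegrable (fun q => W.pulledEnergy φ ψ p q ^ s) MeasureTheory.volume
            0 W.phiMax ∧
          0 < W.energyMean φ ψ s p) ∧
        AntitoneOn (W.energyMean φ ψ s) (Icc 0 |W.massFlux|) ∧
        ConvexOn ℝ (Icc 0 |W.massFlux|) (W.energyMean φ ψ s) ∧
        ConvexOn ℝ (Icc 0 |W.massFlux|) (fun p => Real.log (W.energyMean φ ψ s p)) := by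
  refine ⟨⟨_, _, W.isPotentialPair⟩, fun φ ψ h => ⟨W.bijOn_hodograph.congr h.eqOn_hodograph,
    fun s _ => ?_⟩⟩
  have hg := h.isHodographInverse
  obtain ⟨A, hA, hsymm, hsum⟩ := EquatorialStokesWave.exists_hasSum_energyMean hg s
  have hpos : ∀ p ∈ Icc 0 |W.massFlux|, 0 < W.energyMean φ ψ s p := fun p hp =>
    mul_pos (one_div_pos.2 W.phiMax_pos) (EquatorialStokesWave.integral_energy_rpow_pos hg s hp)
  have hconv : ∀ α : ℝ, ConvexOn ℝ (Icc 0 |W.massFlux|)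
      fun p => Real.exp (α * p) * W.energyMean φ ψ s p := fun α =>
    exp_mul_convexOn_of_hasSum (convex_Icc _ _) hA
      (lam := fun n : ℤ => 4 * Real.pi / W.phiMax * n) hsum α
  refine ⟨fun p hp => ⟨?_, hpos p hp⟩, antitoneOn_of_hasSum_symm hA hsymm hsum, ?_,
    convexOn_log_of_exp_mul hpos hconv⟩
  · exact (EquatorialStokesWave.continuousOn_energy_rpow hg s hp).intervalIntegrable_of_Icc
      W.phiMax_pos.le
  · simpa using hconv 0
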